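/- Let $(\mathcal X,\rho)$ be a separable metric space with its Borel $\sigma$-algebra, and let $(m_n)_{n\ge1}$ be a sequence of nonnegative integers such that $m_n\to\infty$ and $m_n\log n/n\to0$ as $n\to\infty$. Let $(X,Y)$ be any random pair with values in $\mathcal X\times\mathbb R$ such that $\mathbb E|Y|<\infty$, let $\mu$ be the distribution of $X$, and let $f(x)=\mathbb E\{Y\mid X=x\}$ be the regression function. Let $(X_1,Y_1),(X_2,Y_2),\dots$ be independent copies of $(X,Y)$ and, independently of these, let $X'_1,X'_2,\dots$ be independent copies of $X$. For $m\ge1$ and $1\le\ell\le m$ let $$A_{m,\ell}=\Big\{x\in\mathcal X:\ \rho(x,X'_\ell)\le\rho(x,X'_i)\text{ for all }1\le i\le m,\ \text{ and }\ \rho(x,X'_\ell)<\rho(x,X'_i)\text{ for all }1\le i<\ell\Big\}$$ be the Voronoi cell of the nucleus $X'_\ell$ (ties are broken by the smallest index), so that $A_{m,1},\dots,A_{m,m}$ is a partition of $\mathcal X$. For $n\ge1$ with $m=m_n\ge1$, define the modified partitioning estimate by $$\tilde f_n(x)=\begin{cases}\dfrac{\sum_{i=1}^n Y_i\,\mathbf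 1_{\{X_i\in A_{m,\ell}\}}}{\sum_{i=1}^n \mathbf 1_{\{X_i\in A_{m,\ell}\}}} & \text{if } \sum_{i=1}^n \mathbf 1_{\{X_i\in A_{m,\ell}\}}\ge\log n,\\[2ex] 0&\text{otherwise,}\end{cases}\qquad x\in A_{m,\ell},\ 1\le\ell\le m,$$ where $0/0=0$ (and $\tilde f_n=0$ for the finitely many $n$ with $m_n=0$). Then $\tilde f_n$ is strongly consistent in $L^1$: $$\lim_{n\to\infty}\int|\tilde f_n(x)-f(x)|\,\mu(dx)=0\qquad\text{almost surely.}$$ -/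

import Mathlib

open MeasureTheory ProbabilityTheory Filter Topology

namespace ProtoNN

/-- The Voronoi cell of the nucleus `nuc l` among the nuclei `nuc 0, …, nuc (m - 1)`: the points
for which `nuc l` is a nearest nucleus, ties being broken in favour of the smaller index. -/
def voronoiCell {S : Type*} [MetricSpace S] {m : ℕ} (nuc : Fin m → S) (l : Fin m) : Set S :=
  {x | (∀ i, dist x (nuc l) ≤ dist x (nuc i)) ∧ ∀ i, i < l → dist x (nuc l) < dist x (nuc i)}

/-- The Voronoi cells of at least one nucleus partition the space. -/
theorem existsUnique_mem_voronoiCell {S : Type*} [MetricSpace S] {m : ℕ} (hm : 0 < m)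
    (nuc : Fin m → S) (x : S) : ∃! l, x ∈ voronoiCell nuc l := by
  classical
  have : Nonempty (Fin m) := ⟨⟨0, hm⟩⟩
  obtain ⟨l₀, hl₀⟩ := Finite.exists_min (fun i => dist x (nuc i))
  let s : Finset (Fin m) := Finset.univ.filter fun l => ∀ i, dist x (nuc l) ≤ dist x (nuc i)
  have hs : s.Nonempty := ⟨l₀, by simpa [s] using hl₀⟩
  have hmin : ∀ i, dist x (nuc (s.min' hs)) ≤ dist x (nuc i) := by
    have h := s.min'_mem hs
    simpa [s] using h
  refine ⟨s.min' hs, ⟨hmin, fun i hi => ?_⟩, fun l hl => ?_⟩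
  · by_contra hcon
    have hmem : i ∈ s := by
      simp only [s, Finset.mem_filter, Finset.mem_univ, true_and]
      exact fun j => (not_lt.mp hcon).trans (hmin j)
    exact absurd (s.min'_le i hmem) (not_le.mpr hi)
  · have hmem : l ∈ s := by
      simp only [s, Finset.mem_filter, Finset.mem_univ, true_and]
      exact hl.1
    refine le_antisymm ?_ (s.min'_le l hmem)
    by_contra hcon
    exact absurd (hl.2 _ (not_le.mp hcon)) (not_lt.mpr (hmin l))

/-- The number of the points `x 0, …, x (n - 1)` that lie in `A`, as a real number. -/
noncomputable def cellCount {S : Type*} (n : ℕ) (x : ℕ → S) (A : Set S) : ℝ :=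
  ∑ i ∈ Finset.range n, A.indicator (fun _ => (1 : ℝ)) (x i)

/-- The average of those `y i`, `i < n`, for which `x i ∈ A` (with `0 / 0 = 0`). -/
noncomputable def cellAverage {S : Type*} (n : ℕ) (x : ℕ → S) (y : ℕ → ℝ) (A : Set S) : ℝ :=
  (∑ i ∈ Finset.range n, A.indicator (fun _ => y i) (x i)) / cellCount n x A

open Classical in
/-- The modified partitioning estimate built from the sample `(x 0, y 0), …, (x (n - 1), y (n - 1))`
and the Voronoi partition of `nuc`: at a point of the cell `A` its value is the average of the labels
in `A` if `A` contains at least `log n` sample points, and `0` otherwise. -/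
noncomputable def modifiedEstimate {S : Type*} [MetricSpace S] {m : ℕ} (nuc : Fin m → S) (n : ℕ)
    (x : ℕ → S) (y : ℕ → ℝ) (p : S) : ℝ :=
  ∑ l : Fin m, (voronoiCell nuc l).indicator
    (fun _ => if Real.log n ≤ cellCount n x (voronoiCell nuc l)
      then cellAverage n x y (voronoiCell nuc l) else 0) p

open Classical in
/-- The sum in `modifiedEstimate` is the piecewise definition over the cells. -/
theorem modifiedEstimate_of_mem {S : Type*} [MetricSpace S] {m : ℕ} (nuc : Fin m → S) (n : ℕ)
    (x : ℕ → S) (y : ℕ → ℝ) {p : S} {l : Fin m} (hp : p ∈ voronoiCell nuc l) :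
    modifiedEstimate nuc n x y p =
      if Real.log n ≤ cellCount n x (voronoiCell nuc l)
        then cellAverage n x y (voronoiCell nuc l) else 0 := by
  have hm : 0 < m := l.pos
  unfold modifiedEstimate
  rw [Finset.sum_eq_single l]
  · rw [Set.indicator_of_mem hp]
  · intro k _ hk
    exact Set.indicator_of_notMem
      (fun h => hk ((existsUnique_mem_voronoiCell hm nuc p).unique h hp)) _
  · exact fun h => absurd (Finset.mem_univ l) h

/-- `f` is (a version of) the regression function `x ↦ E[Y | X = x]` of a pair `(X, Y)` with
distribution `ν`: it is measurable and `f(X)` is a version of `E[Y | X]`. -/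
def IsRegressionFunction {S : Type*} [MeasurableSpace S] (ν : Measure (S × ℝ)) (f : S → ℝ) : Prop :=
  Measurable f ∧
    (fun z : S × ℝ => f z.1) =ᵐ[ν]
      ν[(fun z : S × ℝ => z.2) | MeasurableSpace.comap Prod.fst inferInstance]

end ProtoNN

namespace ProtoNN

/-! By independence of the two samples and Fubini (`ae_mem_of_ae_ae_mem_of_indepFun`), the nuclei
may be frozen at a typical realisation, so that the Voronoi cells become a deterministic sequence of
partitions. A typical realisation is dense in the support of `μ` (`ae_ae_forall_exists_dist_lt`);
hence the nearest nucleus converges to almost every point, and any integrable `f` is approximated in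
`L¹` by functions constant on the cells (`eventually_exists_sum_setIntegral_voronoiCell_le`).

For deterministic cells (`ae_tendsto_integral_abs_modified_sub`) the labels are split into a part
truncated at `L` and a residual. Counts and truncated label sums are bounded empirical quantities.
Their total deviation over `m` cells is a maximum over `2 ^ m` sign patterns, so Hoeffding's
inequality, `m = o(n)` and Borel–Cantelli make it `o(n)` almost surely. The residual is unbounded,
and its cell sum is divided by the cell count instead of by `n` times the mass of the cell. Here the
threshold `log n` enters: by Chernoff's bound, almost surely from some `n` on, every retained cell
satisfies `n μ(A) ≤ 8 · count`. The residuals therefore cost at most eight times their global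
average, which the strong law controls and truncation at a high level makes small. A discarded cell
has mass at most `log n / n` plus its count deviation, and summing over the cells costs `m log n / n
→ 0`. -/

theorem ae_eventually_notMem_of_summable {Ω : Type*} [MeasurableSpace Ω] {P : Measure Ω}
    [IsFiniteMeasure P] {s : ℕ → Set Ω} {u : ℕ → ℝ} (hu : Summable u)
    (h : ∀ᶠ n in atTop, P.real (s n) ≤ u n) : ∀ᵐ ω ∂P, ∀ᶠ n in atTop, ω ∉ s n := by
  obtain ⟨N, hN⟩ := eventually_atTop.1 h
  have hs : ∑' i, P (s (i + N)) ≠ ⊤ := by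
    have hu' : Summable fun i => u (i + N) := (summable_nat_add_iff N).2 hu
    refine ne_top_of_le_ne_top hu'.tsum_ofReal_ne_top (ENNReal.tsum_le_tsum fun i => ?_)
    rw [← ENNReal.ofReal_toReal (measure_ne_top P (s (i + N)))]
    exact ENNReal.ofReal_le_ofReal (hN _ (Nat.le_add_left _ _))
  filter_upwards [ae_eventually_notMem hs] with ω hω
  obtain ⟨M, hM⟩ := eventually_atTop.1 hω
  refine eventually_atTop.2 ⟨M + N, fun n hn => ?_⟩
  have := hM (n - N) (by omega)
  rwa [Nat.sub_add_cancel (by omega)] at this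

/-! ### Exponential inequalities and Borel–Cantelli for empirical measures. -/

section Concentration

variable {E Ω : Type*} [MeasurableSpace E] [MeasurableSpace Ω] {P : Measure Ω}
  {ν : Measure E} {Z : ℕ → Ω → E}

theorem integral_comp_eq_of_map_eq (hZ : ∀ i, Measurable (Z i)) (hlaw : ∀ i, P.map (Z i) = ν)
    {φ : E → ℝ} (hφ : Measurable φ) (i : ℕ) : ∫ ω, φ (Z i ω) ∂P = ∫ z, φ z ∂ν := by
  rw [← hlaw i, integral_map (hZ i).aemeasurable hφ.aestronglyMeasurable]

variable [IsProbabilityMeasure P]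

/-- Hoeffding's inequality for the empirical means of a bounded function. -/
theorem measureReal_sum_sub_integral_ge_le (hZ : ∀ i, Measurable (Z i))
    (hlaw : ∀ i, P.map (Z i) = ν) (hind : iIndepFun Z P) {φ : E → ℝ} (hφ : Measurable φ)
    {L : ℝ} (hL : 0 < L) (hb : ∀ z, |φ z| ≤ L) (n : ℕ) {ε : ℝ} (hε : 0 ≤ ε) :
    P.real {ω | n * ε ≤ ∑ i ∈ Finset.range n, (φ (Z i ω) - ∫ z, φ z ∂ν)} ≤
      Real.exp (-(n * (ε ^ 2 / (2 * L ^ 2)))) := by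
  have hsub : ∀ i < n, HasSubgaussianMGF (fun ω => φ (Z i ω) - ∫ z, φ z ∂ν)
      ((‖L - -L‖₊ / 2) ^ 2) P := fun i _ => by
    have h := hasSubgaussianMGF_of_mem_Icc (μ := P) (X := fun ω => φ (Z i ω)) (a := -L) (b := L)
      (hφ.comp (hZ i)).aemeasurable (ae_of_all _ fun ω => abs_le.1 (hb _))
    simpa only [integral_comp_eq_of_map_eq hZ hlaw hφ i] using h
  have hind' : iIndepFun (fun i ω => φ (Z i ω) - ∫ z, φ z ∂ν) P :=
    hind.comp (fun _ z => φ z - ∫ z, φ z ∂ν) fun _ => hφ.sub_const _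
  refine (HasSubgaussianMGF.measure_sum_range_ge_le_of_iIndepFun hind' hsub
    (by positivity : 0 ≤ n * ε)).trans (Real.exp_le_exp.2 (le_of_eq ?_))
  have hc : (((‖L - -L‖₊ / 2) ^ 2 : NNReal) : ℝ) = L ^ 2 := by
    push_cast
    rw [Real.norm_eq_abs, abs_of_pos (by linarith)]
    ring
  rw [hc]
  rcases Nat.eq_zero_or_pos n with rfl | hn
  · simp
  · have : (0 : ℝ) < n := by exact_mod_cast hn
    field_simp

/-- The `L¹` deviation over disjoint cells of the empirical version of the measure with bounded
density `h` exceeds `ε` with exponentially small probability. -/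
theorem measureReal_sum_abs_sub_setIntegral_ge_le [IsProbabilityMeasure ν]
    (hZ : ∀ i, Measurable (Z i))
    (hlaw : ∀ i, P.map (Z i) = ν) (hind : iIndepFun Z P) {h : E → ℝ} (hh : Measurable h)
    {L : ℝ} (hL : 0 < L) (hb : ∀ z, |h z| ≤ L) {m : ℕ} {B : Fin m → Set E}
    (hB : ∀ l, MeasurableSet (B l)) (hdisj : Pairwise (Function.onFun Disjoint B))
    (n : ℕ) {ε : ℝ} (hε : 0 ≤ ε) :
    P.real {ω | n * ε ≤ ∑ l, |∑ i ∈ Finset.range n, (B l).indicator h (Z i ω) -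
        n * ∫ z in B l, h z ∂ν|} ≤
      2 ^ m * Real.exp (-(n * (ε ^ 2 / (2 * L ^ 2)))) := by
  classical
  let sg : Bool → ℝ := fun b => if b then 1 else -1
  have hsg : ∀ b, |sg b| = 1 := by intro b; cases b <;> simp [sg]
  -- A sum of absolute values is the largest of its signed sums. Each signed sum is an empirical sum
  -- of a single function, still bounded by `L` because at most one cell contains a given point.
  let φ : (Fin m → Bool) → E → ℝ := fun s z => ∑ l, sg (s l) * (B l).indicator h z
  have hφ : ∀ s, Measurable (φ s) := fun s =>
    Finset.measurable_sum _ fun l _ => (hh.indicator (hB l)).const_mul _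
  have hφb : ∀ s z, |φ s z| ≤ L := fun s z => by
    by_cases hz : ∃ l, z ∈ B l
    · obtain ⟨l, hl⟩ := hz
      have : φ s z = sg (s l) * h z := by
        simp only [φ]
        rw [Finset.sum_eq_single l, Set.indicator_of_mem hl]
        · intro k _ hk
          rw [Set.indicator_of_notMem, mul_zero]
          exact fun hk' => (Set.disjoint_left.1 (hdisj hk) hk') hl
        · simp
      rw [this, abs_mul, hsg, one_mul]
      exact hb z
    · push Not at hz
      have : φ s z = 0 := Finset.sum_eq_zero fun l _ => by
        rw [Set.indicator_of_notMem (hz l), mul_zero]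
      rw [this, abs_zero]
      exact hL.le
  have hint : Integrable h ν :=
    Integrable.of_bound hh.aestronglyMeasurable L (ae_of_all _ hb)
  have hφi : ∀ s, ∫ z, φ s z ∂ν = ∑ l, sg (s l) * ∫ z in B l, h z ∂ν := fun s => by
    simp only [φ]
    rw [integral_finsetSum _ fun l _ => (hint.indicator (hB l)).const_mul _]
    refine Finset.sum_congr rfl fun l _ => ?_
    rw [integral_const_mul, integral_indicator (hB l)]
  have hsub : {ω | n * ε ≤ ∑ l, |∑ i ∈ Finset.range n, (B l).indicator h (Z i ω) -
        n * ∫ z in B l, h z ∂ν|} ⊆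
      ⋃ s ∈ (Finset.univ : Finset (Fin m → Bool)),
        {ω | n * ε ≤ ∑ i ∈ Finset.range n, (φ s (Z i ω) - ∫ z, φ s z ∂ν)} := by
    intro ω hω
    simp only [Set.mem_iUnion, Finset.mem_univ, exists_prop, true_and]
    refine ⟨fun l => decide (0 ≤ ∑ i ∈ Finset.range n, (B l).indicator h (Z i ω) -
        n * ∫ z in B l, h z ∂ν), ?_⟩
    rw [Set.mem_ofPred_eq] at hω ⊢
    refine hω.trans (le_of_eq ?_)
    rw [Finset.sum_sub_distrib, hφi]
    simp only [φ, Finset.sum_const, Finset.card_range, nsmul_eq_mul]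
    rw [Finset.sum_comm, Finset.mul_sum, ← Finset.sum_sub_distrib]
    refine Finset.sum_congr rfl fun l _ => ?_
    rw [← Finset.mul_sum, mul_left_comm, ← mul_sub]
    by_cases h0 : 0 ≤ ∑ i ∈ Finset.range n, (B l).indicator h (Z i ω) - n * ∫ z in B l, h z ∂ν
    · simp only [sg, h0, decide_true, if_true, one_mul, abs_of_nonneg]
    · simp only [sg, h0, decide_false, Bool.false_eq_true, if_false]
      rw [abs_of_neg (not_le.1 h0)]
      ring
  calc _ ≤ P.real (⋃ s ∈ (Finset.univ : Finset (Fin m → Bool)),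
        {ω | n * ε ≤ ∑ i ∈ Finset.range n, (φ s (Z i ω) - ∫ z, φ s z ∂ν)}) :=
        measureReal_mono hsub (measure_ne_top _ _)
    _ ≤ ∑ s : Fin m → Bool,
        P.real {ω | n * ε ≤ ∑ i ∈ Finset.range n, (φ s (Z i ω) - ∫ z, φ s z ∂ν)} :=
        measureReal_biUnion_finset_le _ _
    _ ≤ ∑ s : Fin m → Bool, Real.exp (-(n * (ε ^ 2 / (2 * L ^ 2)))) :=
        Finset.sum_le_sum fun s _ =>
          measureReal_sum_sub_integral_ge_le hZ hlaw hind (hφ s) hL (hφb s) n hε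
    _ = _ := by simp

/-- Over disjoint cells whose number is `o(n)`, the empirical version of the measure with bounded
density `h` converges almost surely in `L¹`. -/
theorem ae_tendsto_sum_abs_sub_setIntegral [IsProbabilityMeasure ν] (hZ : ∀ i, Measurable (Z i))
    (hlaw : ∀ i, P.map (Z i) = ν) (hind : iIndepFun Z P) {h : E → ℝ} (hh : Measurable h)
    {L : ℝ} (hL : 0 < L) (hb : ∀ z, |h z| ≤ L) {m : ℕ → ℕ}
    (hm : Tendsto (fun n : ℕ => (m n : ℝ) / n) atTop (𝓝 0)) {B : ∀ n, Fin (m n) → Set E}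
    (hB : ∀ n l, MeasurableSet (B n l)) (hdisj : ∀ n, Pairwise (Function.onFun Disjoint (B n))) :
    ∀ᵐ ω ∂P, Tendsto (fun n : ℕ => (∑ l, |∑ i ∈ Finset.range n, (B n l).indicator h (Z i ω) -
      n * ∫ z in B n l, h z ∂ν|) / n) atTop (𝓝 0) := by
  have key : ∀ k : ℕ, ∀ᵐ ω ∂P, ∀ᶠ n : ℕ in atTop,
      ω ∉ {ω | n * (1 / ((k : ℝ) + 1)) ≤
        ∑ l, |∑ i ∈ Finset.range n, (B n l).indicator h (Z i ω) -
          n * ∫ z in B n l, h z ∂ν|} := fun k => by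
    set ε : ℝ := 1 / ((k : ℝ) + 1) with hεdef
    have hε : 0 < ε := by positivity
    -- Half of the Hoeffding exponent: once `m n / n < c`, the factor `2 ^ m ≤ exp m` uses up one
    -- half, and the other leaves the geometric bound `exp (-c) ^ n`.
    set c : ℝ := ε ^ 2 / (4 * L ^ 2) with hc
    have hcpos : 0 < c := by positivity
    have hc2 : ε ^ 2 / (2 * L ^ 2) = 2 * c := by rw [hc]; field_simp; ring
    refine ae_eventually_notMem_of_summable (u := fun n : ℕ => Real.exp (-c) ^ n)
      (summable_geometric_of_lt_one (Real.exp_pos _).le (Real.exp_zero ▸ Real.exp_lt_exp.2 (by linarith))) ?_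
    filter_upwards [hm.eventually (gt_mem_nhds hcpos), eventually_gt_atTop 0] with n hn hn0
    refine (measureReal_sum_abs_sub_setIntegral_ge_le hZ hlaw hind hh hL hb (hB n) (hdisj n) n
      hε.le).trans ?_
    have hn0' : (0 : ℝ) < n := by exact_mod_cast hn0
    rw [div_lt_iff₀ hn0'] at hn
    have h2 : (2 : ℝ) ^ m n ≤ Real.exp (m n) := by
      rw [← mul_one (m n : ℝ), Real.exp_nat_mul]
      exact pow_le_pow_left₀ (by norm_num) (by linarith [Real.add_one_le_exp (1 : ℝ)]) _
    calc _ ≤ Real.exp (m n) * Real.exp (-(n * (ε ^ 2 / (2 * L ^ 2)))) := by gcongr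
      _ ≤ Real.exp (n * (-c)) := by
        rw [← Real.exp_add, hc2]
        exact Real.exp_le_exp.2 (by linarith)
      _ = _ := Real.exp_nat_mul _ _
  filter_upwards [ae_all_iff.2 key] with ω hω
  refine tendsto_order.2 ⟨fun a ha => Eventually.of_forall fun n => ha.trans_le (by positivity),
    fun a ha => ?_⟩
  obtain ⟨k, hk⟩ := exists_nat_one_div_lt ha
  filter_upwards [hω k, eventually_gt_atTop 0] with n hn hn0
  have hn0' : (0 : ℝ) < n := by exact_mod_cast hn0
  replace hn := not_le.1 hn
  rw [div_lt_iff₀ hn0']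
  nlinarith

/-- Chernoff's bound for the lower tail of a binomial count. -/
theorem measureReal_eight_mul_sum_indicator_le [IsProbabilityMeasure ν]
    (hZ : ∀ i, Measurable (Z i))
    (hlaw : ∀ i, P.map (Z i) = ν) (hind : iIndepFun Z P) {B : Set E} (hB : MeasurableSet B)
    (n : ℕ) :
    P.real {ω | 8 * ∑ i ∈ Finset.range n, B.indicator (fun _ => (1 : ℝ)) (Z i ω) ≤
      n * ν.real B} ≤ Real.exp (-(n * ν.real B / 2)) := by
  set φ : E → ℝ := B.indicator fun _ => (1 : ℝ) with hφdef
  have hφ : Measurable φ := measurable_const.indicator hB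
  have h01 : ∀ z, 0 ≤ φ z ∧ φ z ≤ 1 := fun z => by
    by_cases hz : z ∈ B <;> simp [hφdef, hz]
  have hXm : ∀ i, Measurable fun ω => φ (Z i ω) := fun i => hφ.comp (hZ i)
  have hind' : iIndepFun (fun i ω => φ (Z i ω)) P := hind.comp (fun _ => φ) fun _ => hφ
  -- The Chernoff parameter is fixed at `-1`. As `exp (-1) ≤ 3 / 8`, a Bernoulli variable of mean
  -- `p` has transform at most `1 - 5p/8 ≤ exp (-5p/8)`; with the threshold `np/8` the exponent is
  -- `np/8 - 5np/8 = -np/2`.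
  have hmgf : ∀ i, mgf (fun ω => φ (Z i ω)) P (-1) ≤ Real.exp (-(5 / 8 * ν.real B)) := fun i => by
    have he : Real.exp (-1) ≤ 3 / 8 := by
      rw [Real.exp_neg, inv_le_comm₀ (Real.exp_pos _) (by norm_num)]
      have := Real.exp_one_gt_d9
      norm_num
      linarith
    have h1 : mgf (fun ω => φ (Z i ω)) P (-1) = ∫ z, Real.exp (-1 * φ z) ∂ν := by
      rw [mgf]
      exact integral_comp_eq_of_map_eq hZ hlaw (φ := fun z => Real.exp (-1 * φ z))
        ((hφ.const_mul _).exp) i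
    have h2 : ∀ z, Real.exp (-1 * φ z) ≤ 1 - 5 / 8 * φ z := fun z => by
      by_cases hz : z ∈ B
      · simp only [hφdef, Set.indicator_of_mem hz]; norm_num; linarith
      · simp [hφdef, hz]
    have hφint : Integrable φ ν := (integrable_const (1 : ℝ)).indicator hB
    have h3 : ∫ z, Real.exp (-1 * φ z) ∂ν ≤ ∫ z, (1 - 5 / 8 * φ z) ∂ν := by
      refine integral_mono_of_nonneg (ae_of_all _ fun z => (Real.exp_pos _).le)
        ((integrable_const _).sub (hφint.const_mul _)) (ae_of_all _ h2)
    have h4 : ∫ z, (1 - 5 / 8 * φ z) ∂ν = 1 - 5 / 8 * ν.real B := by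
      rw [integral_sub (integrable_const _) (hφint.const_mul _), integral_const_mul, hφdef,
        integral_indicator hB]
      simp
    rw [h1]
    have := Real.add_one_le_exp (-(5 / 8 * ν.real B))
    linarith
  have hsum : mgf (∑ i ∈ Finset.range n, fun ω => φ (Z i ω)) P (-1) ≤
      Real.exp (n * (-(5 / 8 * ν.real B))) := by
    rw [hind'.mgf_sum hXm, Real.exp_nat_mul]
    calc _ ≤ ∏ i ∈ Finset.range n, Real.exp (-(5 / 8 * ν.real B)) :=
        Finset.prod_le_prod (fun _ _ => mgf_nonneg) fun i _ => hmgf i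
      _ = _ := by simp
  have hSm : Measurable (∑ i ∈ Finset.range n, fun ω => φ (Z i ω)) :=
    by simpa only [Finset.sum_fn] using Finset.measurable_sum _ fun i _ => hXm i
  have hint : Integrable
      (fun ω => Real.exp (-1 * (∑ i ∈ Finset.range n, fun ω => φ (Z i ω)) ω)) P := by
    refine Integrable.of_bound (hSm.const_mul _).exp.aestronglyMeasurable 1
      (ae_of_all _ fun ω => ?_)
    rw [Real.norm_eq_abs, Real.abs_exp, Real.exp_le_one_iff, Finset.sum_apply]
    have : 0 ≤ ∑ i ∈ Finset.range n, φ (Z i ω) := Finset.sum_nonneg fun i _ => (h01 _).1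
    linarith
  have hset : {ω | 8 * ∑ i ∈ Finset.range n, φ (Z i ω) ≤ n * ν.real B} =
      {ω | (∑ i ∈ Finset.range n, fun ω => φ (Z i ω)) ω ≤ n * ν.real B / 8} := by
    ext ω
    simp only [Set.mem_ofPred_eq, Finset.sum_apply]
    constructor <;> intro h <;> linarith
  rw [hset]
  refine (measure_le_le_exp_mul_mgf _ (by norm_num) hint).trans ?_
  calc _ ≤ Real.exp (- -1 * (n * ν.real B / 8)) * Real.exp (n * (-(5 / 8 * ν.real B))) := by gcongr
    _ = _ := by rw [← Real.exp_add]; congr 1; ring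

/-- Almost surely, from some sample size on, every one of at most `n` cells that contains at least
`log n` of the first `n` sample points has empirical mass at least an eighth of its mass. -/
theorem ae_eventually_mul_measureReal_le_eight_mul [IsProbabilityMeasure ν]
    (hZ : ∀ i, Measurable (Z i))
    (hlaw : ∀ i, P.map (Z i) = ν) (hind : iIndepFun Z P) {m : ℕ → ℕ}
    (hm : ∀ᶠ n in atTop, m n ≤ n) {B : ∀ n, Fin (m n) → Set E}
    (hB : ∀ n l, MeasurableSet (B n l)) :
    ∀ᵐ ω ∂P, ∀ᶠ n : ℕ in atTop, ∀ l : Fin (m n),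
      Real.log n ≤ ∑ i ∈ Finset.range n, (B n l).indicator (fun _ => (1 : ℝ)) (Z i ω) →
      n * ν.real (B n l) ≤
        8 * ∑ i ∈ Finset.range n, (B n l).indicator (fun _ => (1 : ℝ)) (Z i ω) := by
  have key := ae_eventually_notMem_of_summable (P := P)
    (s := fun n => ⋃ l ∈ (Finset.univ : Finset (Fin (m n))), {ω |
      Real.log n ≤ ∑ i ∈ Finset.range n, (B n l).indicator (fun _ => (1 : ℝ)) (Z i ω) ∧
      8 * ∑ i ∈ Finset.range n, (B n l).indicator (fun _ => (1 : ℝ)) (Z i ω) <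
        n * ν.real (B n l)})
    (u := fun n : ℕ => 1 / (n : ℝ) ^ 3) (Real.summable_one_div_nat_pow.2 (by norm_num)) ?_
  · filter_upwards [key] with ω hω
    filter_upwards [hω] with n hn l hl
    by_contra hcon
    exact hn (Set.mem_biUnion (Finset.mem_univ l) ⟨hl, not_le.1 hcon⟩)
  · filter_upwards [hm, eventually_gt_atTop 0] with n hmn hn0
    have hn0' : (0 : ℝ) < n := by exact_mod_cast hn0
    have hone : ∀ l : Fin (m n), P.real {ω |
        Real.log n ≤ ∑ i ∈ Finset.range n, (B n l).indicator (fun _ => (1 : ℝ)) (Z i ω) ∧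
        8 * ∑ i ∈ Finset.range n, (B n l).indicator (fun _ => (1 : ℝ)) (Z i ω) <
          n * ν.real (B n l)} ≤ 1 / (n : ℝ) ^ 4 := fun l => by
      -- A heavy cell fails with probability at most `exp (-4 log n) = n ^ (-4)`. For a light cell a
      -- count of at least `log n` already gives the inequality, so the event is empty. At most `n`
      -- cells leave the summable bound `n ^ (-3)`.
      by_cases hp : 8 * Real.log n < n * ν.real (B n l)
      · refine (measureReal_mono (fun ω hω => hω.2.le) (measure_ne_top _ _)).trans
          ((measureReal_eight_mul_sum_indicator_le hZ hlaw hind (hB n l) n).trans ?_)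
        calc _ ≤ Real.exp ((4 : ℕ) * -Real.log n) :=
            Real.exp_le_exp.2 (by push_cast; linarith)
          _ = _ := by
            rw [Real.exp_nat_mul, Real.exp_neg, Real.exp_log hn0', inv_pow, one_div]
      · have : {ω |
            Real.log n ≤ ∑ i ∈ Finset.range n, (B n l).indicator (fun _ => (1 : ℝ)) (Z i ω) ∧
            8 * ∑ i ∈ Finset.range n, (B n l).indicator (fun _ => (1 : ℝ)) (Z i ω) <
              n * ν.real (B n l)} = ∅ := by
          ext ω
          simp only [Set.mem_ofPred_eq, Set.mem_empty_iff_false, iff_false, not_and, not_lt]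
          intro h
          linarith
        rw [this, measureReal_empty]
        positivity
    refine (measureReal_biUnion_finset_le _ _).trans ((Finset.sum_le_sum fun l _ => hone l).trans ?_)
    have : (m n : ℝ) ≤ n := by exact_mod_cast hmn
    rw [Finset.sum_const, Finset.card_univ, Fintype.card_fin, nsmul_eq_mul]
    calc (m n : ℝ) * (1 / (n : ℝ) ^ 4) ≤ n * (1 / (n : ℝ) ^ 4) := by gcongr
      _ = _ := by field_simp

end Concentration

/-! ### The regression function as a conditional expectation. -/

section Regression

variable {S : Type*} [MeasurableSpace S] {ν : Measure (S × ℝ)} {f : S → ℝ}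

theorem IsRegressionFunction.integrable (hf : IsRegressionFunction ν f) :
    Integrable f (ν.map Prod.fst) := by
  rw [integrable_map_measure hf.1.aestronglyMeasurable measurable_fst.aemeasurable]
  exact integrable_condExp.congr hf.2.symm

/-- The cylinder over `A` belongs to the σ-algebra generated by the first coordinate, where the
label and its conditional expectation have equal integrals. -/
theorem IsRegressionFunction.setIntegral_eq [IsFiniteMeasure ν] (hf : IsRegressionFunction ν f)
    (hν : Integrable (fun z : S × ℝ => z.2) ν) {A : Set S} (hA : MeasurableSet A) :
    ∫ x in A, f x ∂(ν.map Prod.fst) = ∫ z in Prod.fst ⁻¹' A, z.2 ∂ν := by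
  have hle : MeasurableSpace.comap (Prod.fst : S × ℝ → S) inferInstance ≤
      (inferInstance : MeasurableSpace (S × ℝ)) := measurable_fst.comap_le
  rw [setIntegral_map hA hf.1.aestronglyMeasurable measurable_fst.aemeasurable,
    ← setIntegral_condExp hle hν ⟨A, hA, rfl⟩]
  exact setIntegral_congr_ae (measurable_fst hA) (hf.2.mono fun z hz _ => hz)

end Regression

/-! ### Cellwise estimates of the `L¹` error. -/

section Partition

variable {E : Type*} {m : ℕ} {B : Fin m → Set E}

theorem sum_indicator_of_mem (hdisj : Pairwise (Function.onFun Disjoint B)) {l : Fin m} {z : E}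
    (hz : z ∈ B l) (v : Fin m → E → ℝ) : ∑ k, (B k).indicator (v k) z = v l z := by
  rw [Finset.sum_eq_single l, Set.indicator_of_mem hz]
  · exact fun k _ hk => Set.indicator_of_notMem
      (fun hk' => (Set.disjoint_left.1 (hdisj hk) hk') hz) _
  · simp

theorem integral_eq_sum_setIntegral [MeasurableSpace E] {μ : Measure E}
    (hB : ∀ l, MeasurableSet (B l)) (hdisj : Pairwise (Function.onFun Disjoint B))
    (huniv : ⋃ l, B l = Set.univ) {g : E → ℝ} (hg : Integrable g μ) :
    ∫ z, g z ∂μ = ∑ l, ∫ z in B l, g z ∂μ := by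
  rw [← integral_iUnion_fintype hB hdisj fun l => hg.integrableOn, huniv, setIntegral_univ]

/-- Compare `v` and `f` through `c`: the distance `|v - c|` times the mass is bounded by comparing
integrals over `A`, which costs a second copy of the approximation error. What remains to control is
the integral of `v - f`, a purely statistical quantity. -/
theorem setIntegral_abs_const_sub_le [MeasurableSpace E] {μ : Measure E} [IsFiniteMeasure μ]
    {A : Set E} {f : E → ℝ} (hf : Integrable f μ) (v c : ℝ) :
    ∫ x in A, |v - f x| ∂μ ≤
      |v * μ.real A - ∫ x in A, f x ∂μ| + 2 * ∫ x in A, |f x - c| ∂μ := by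
  have hfA : IntegrableOn f A μ := hf.integrableOn
  have hcst : ∀ c : ℝ, IntegrableOn (fun _ => c) A μ := fun c => integrable_const _
  have habs : IntegrableOn (fun x => |f x - c|) A μ := (hfA.sub (hcst c)).abs
  have hci : ∀ c : ℝ, ∫ _ in A, c ∂μ = c * μ.real A := fun c => by
    rw [setIntegral_const, smul_eq_mul, mul_comm]
  have h1 : ∫ x in A, |v - f x| ∂μ ≤ ∫ x in A, (|v - c| + |f x - c|) ∂μ := by
    refine setIntegral_mono ((hcst v).sub hfA).abs ((hcst _).add habs) fun x => ?_
    have := abs_sub_le v c (f x)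
    rwa [abs_sub_comm c] at this
  rw [integral_add (hcst _) habs, hci] at h1
  have h2 : |v - c| * μ.real A ≤
      |v * μ.real A - ∫ x in A, f x ∂μ| + ∫ x in A, |f x - c| ∂μ := by
    have h3 : |∫ x in A, (f x - c) ∂μ| ≤ ∫ x in A, |f x - c| ∂μ := abs_integral_le_integral_abs
    rw [integral_sub hfA (hcst c), hci] at h3
    calc |v - c| * μ.real A = |(v - c) * μ.real A| := by
          rw [abs_mul, abs_of_nonneg (measureReal_nonneg : 0 ≤ μ.real A)]
      _ = |(v * μ.real A - ∫ x in A, f x ∂μ) + ((∫ x in A, f x ∂μ) - c * μ.real A)| := by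
          congr 1; ring
      _ ≤ _ := (abs_add_le _ _).trans (by linarith)
  linarith

end Partition

/-- The error of the modified local average over one cell of mass `a` with `q` of the `n` sample
points, in terms of the deviations of the empirical mass and of the truncated label sum. -/
theorem abs_modified_average_mul_sub_le {n a q F T w L st sy sw lg v : ℝ} (hn : 0 < n)
    (ha : 0 ≤ a) (hL : 0 ≤ L) (hlg : 0 < lg)
    (hT : |T| ≤ L * a) (hFT : |F - T| ≤ w) (hst : |st| ≤ L * q) (hsy : |sy - st| ≤ sw)
    (hq : lg ≤ q → n * a ≤ 8 * q) (hgood : lg ≤ q → v = sy / q) (hbad : ¬ lg ≤ q → v = 0) :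
    |v * a - F| ≤ L * (|q - n * a| / n) + |st - n * T| / n + 8 * (sw / n) + w + L * (lg / n) := by
  have hsw₀ : 0 ≤ sw := (abs_nonneg _).trans hsy
  have hsw : 0 ≤ sw / n := by positivity
  have hl : 0 ≤ L * (lg / n) := by positivity
  by_cases h : lg ≤ q
  · have hqpos : 0 < q := hlg.trans_le h
    -- The four terms are the residual labels, the count deviation weighted by an average of
    -- truncated labels (at most `L`), the deviation of the truncated sum, and the truncation bias.
    -- Only the first needs `n * a ≤ 8 * q`.
    have e : v * a - F = (sy - st) * (a / q) + (st / q) * ((n * a - q) / n) +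
        (st - n * T) / n + (T - F) := by
      rw [hgood h]; field_simp; ring
    have b1 : |(sy - st) * (a / q)| ≤ 8 * (sw / n) := by
      rw [abs_mul, abs_of_nonneg (by positivity : 0 ≤ a / q)]
      have : a / q ≤ 8 / n := by
        rw [div_le_div_iff₀ hqpos hn]
        linarith [hq h]
      calc _ ≤ sw * (8 / n) := by gcongr
        _ = _ := by ring
    have b2 : |(st / q) * ((n * a - q) / n)| ≤ L * (|q - n * a| / n) := by
      rw [abs_mul, abs_div, abs_div, abs_of_pos hqpos, abs_of_pos hn, abs_sub_comm]
      have : |st| / q ≤ L := (div_le_iff₀ hqpos).2 hst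
      gcongr
    have b3 : |(st - n * T) / n| = |st - n * T| / n := by rw [abs_div, abs_of_pos hn]
    have b4 : |T - F| ≤ w := by rwa [abs_sub_comm]
    rw [e]
    have := abs_add_le ((sy - st) * (a / q) + (st / q) * ((n * a - q) / n) + (st - n * T) / n) (T - F)
    have := abs_add_le ((sy - st) * (a / q) + (st / q) * ((n * a - q) / n)) ((st - n * T) / n)
    have := abs_add_le ((sy - st) * (a / q)) ((st / q) * ((n * a - q) / n))
    linarith
  -- In a discarded cell the error is `|F|`, small because a count below `lg` forces a small mass
  -- `a`.
  · have h3 : 0 ≤ |st - n * T| / n := by positivity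
    rw [hbad h, zero_mul, zero_sub, abs_neg]
    have h1 : |F| ≤ |T| + w := by
      have := abs_add_le T (F - T)
      rw [add_sub_cancel] at this
      linarith
    have h2 : a ≤ |q - n * a| / n + lg / n := by
      rw [← add_div, le_div_iff₀ hn]
      have := neg_le_abs (q - n * a)
      linarith [not_le.1 h]
    have h4 : L * a ≤ L * (|q - n * a| / n) + L * (lg / n) := by
      rw [← mul_add]; gcongr
    linarith

/-! ### Truncation of the labels. -/

section Truncation

/-- The number in `[-L, L]` closest to `y`. -/
noncomputable def truncate (L y : ℝ) : ℝ := max (-L) (min y L)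

theorem measurable_truncate (L : ℝ) : Measurable (truncate L) :=
  measurable_const.max (measurable_id.min measurable_const)

theorem abs_truncate_le {L : ℝ} (hL : 0 ≤ L) (y : ℝ) : |truncate L y| ≤ L :=
  abs_le.2 ⟨le_max_left _ _, max_le (by linarith) (min_le_right _ _)⟩

theorem truncate_of_abs_le {L y : ℝ} (h : |y| ≤ L) : truncate L y = y := by
  have := abs_le.1 h
  rw [truncate, min_eq_left this.2, max_eq_right this.1]

theorem abs_sub_truncate_le {L : ℝ} (hL : 0 ≤ L) (y : ℝ) : |y - truncate L y| ≤ |y| := by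
  rcases le_total (|y|) L with h | h
  · rw [truncate_of_abs_le h]; simp
  · unfold truncate
    rcases abs_cases y with ⟨h1, h2⟩ | ⟨h1, h2⟩
    · rw [min_eq_right (by linarith), max_eq_right (by linarith), abs_of_nonneg (by linarith)]
      linarith
    · rw [min_eq_left (by linarith), max_eq_left (by linarith), abs_of_nonpos (by linarith)]
      linarith

theorem tendsto_integral_abs_sub_truncate {E : Type*} [MeasurableSpace E] {ν : Measure E}
    {Y : E → ℝ} (hY : Integrable Y ν) :
    Tendsto (fun k : ℕ => ∫ z, |Y z - truncate k (Y z)| ∂ν) atTop (𝓝 0) := by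
  have h := tendsto_integral_of_dominated_convergence (μ := ν)
    (F := fun (k : ℕ) z => |Y z - truncate k (Y z)|) (f := fun _ => 0) (fun z => |Y z|)
    (fun k => (hY.1.sub ((measurable_truncate k).comp_aemeasurable
      hY.aemeasurable).aestronglyMeasurable).norm) hY.abs
    (fun k => ae_of_all _ fun z => by
      rw [Real.norm_eq_abs, abs_abs]
      exact abs_sub_truncate_le k.cast_nonneg _)
    (ae_of_all _ fun z => by
      obtain ⟨k, hk⟩ := exists_nat_ge |Y z|
      refine tendsto_const_nhds.congr' ?_
      filter_upwards [eventually_ge_atTop k] with j hj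
      have : (k : ℝ) ≤ j := by exact_mod_cast hj
      rw [truncate_of_abs_le (hk.trans this), sub_self, abs_zero])
  simpa using h

end Truncation

theorem indicator_preimage_fst {α β : Type*} (A : Set α) (h : α × β → ℝ) (z : α × β) :
    (Prod.fst ⁻¹' A).indicator h z = A.indicator (fun _ => h z) z.1 := by
  by_cases hz : z.1 ∈ A
  · rw [Set.indicator_of_mem (Set.mem_preimage.2 hz), Set.indicator_of_mem hz]
  · rw [Set.indicator_of_notMem (Set.mem_preimage.not.2 hz), Set.indicator_of_notMem hz]

/-! ### Consistency along deterministic partitions. -/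

section FixedPartition

variable {S : Type*} [MeasurableSpace S] {ν : Measure (S × ℝ)} [IsProbabilityMeasure ν] {f : S → ℝ}

open Classical in
/-- The `L¹` error of the modified partitioning estimate is at most the sum of the deviations of the
empirical masses and truncated label sums, the truncation errors and the approximation error. -/
theorem integral_abs_modified_sub_le (hν : Integrable (fun z : S × ℝ => z.2) ν)
    (hf : IsRegressionFunction ν f) {m : ℕ} {A : Fin m → Set S} (hA : ∀ l, MeasurableSet (A l))
    (hdisj : Pairwise (Function.onFun Disjoint A)) (huniv : ⋃ l, A l = Set.univ)
    {L : ℝ} (hL : 0 ≤ L) {n : ℕ} (hn : 1 < n) (x : ℕ → S) (y : ℕ → ℝ)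
    (hq : ∀ l, Real.log n ≤ cellCount n x (A l) →
      n * ν.real (Prod.fst ⁻¹' A l) ≤ 8 * cellCount n x (A l)) (c : Fin m → ℝ) :
    ∫ p, |∑ l, (A l).indicator (fun _ => if Real.log n ≤ cellCount n x (A l)
        then cellAverage n x y (A l) else 0) p - f p| ∂(ν.map Prod.fst) ≤
      L * ((∑ l, |cellCount n x (A l) - n * ν.real (Prod.fst ⁻¹' A l)|) / n) +
      (∑ l, |∑ i ∈ Finset.range n, (A l).indicator (fun _ => truncate L (y i)) (x i) -
        n * ∫ z in Prod.fst ⁻¹' A l, truncate L z.2 ∂ν|) / n +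
      8 * ((∑ i ∈ Finset.range n, |y i - truncate L (y i)|) / n) +
      ∫ z, |z.2 - truncate L z.2| ∂ν + L * (m * Real.log n / n) +
      2 * ∑ l, ∫ p in A l, |f p - c l| ∂(ν.map Prod.fst) := by
  set μ := ν.map Prod.fst with hμ
  have : IsProbabilityMeasure μ := Measure.isProbabilityMeasure_map measurable_fst.aemeasurable
  set v : Fin m → ℝ := fun l => if Real.log n ≤ cellCount n x (A l)
        then cellAverage n x y (A l) else 0 with hv
  have hn0 : (0 : ℝ) < n := by exact_mod_cast (by omega : 0 < n)
  have hlg : 0 < Real.log n := Real.log_pos (by exact_mod_cast hn)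
  have hfi : Integrable f μ := hf.integrable
  have hesti : Integrable (fun p => ∑ l, (A l).indicator (fun _ => v l) p) μ :=
    integrable_finsetSum _ fun l _ => (integrable_const (v l)).indicator (hA l)
  have hB : ∀ l, MeasurableSet ((Prod.fst : S × ℝ → S) ⁻¹' A l) := fun l => measurable_fst (hA l)
  have hBdisj : Pairwise (Function.onFun Disjoint fun l => (Prod.fst : S × ℝ → S) ⁻¹' A l) :=
    fun i j hij => (hdisj hij).preimage _
  have hBuniv : ⋃ l, (Prod.fst : S × ℝ → S) ⁻¹' A l = Set.univ := by
    rw [← Set.preimage_iUnion, huniv, Set.preimage_univ]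
  have hTm : Measurable fun z : S × ℝ => truncate L z.2 :=
    (measurable_truncate L).comp measurable_snd
  have hTi : Integrable (fun z : S × ℝ => truncate L z.2) ν :=
    Integrable.of_bound hTm.aestronglyMeasurable L (ae_of_all _ fun z => abs_truncate_le hL _)
  have hWi : Integrable (fun z : S × ℝ => |z.2 - truncate L z.2|) ν := (hν.sub hTi).abs
  have hμA : ∀ l, μ.real (A l) = ν.real (Prod.fst ⁻¹' A l) := fun l =>
    map_measureReal_apply measurable_fst (hA l)
  have habs : ∀ (l : Fin m) (g h : ℕ → ℝ), (∀ i, |g i| ≤ h i) →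
      |∑ i ∈ Finset.range n, (A l).indicator (fun _ => g i) (x i)| ≤
        ∑ i ∈ Finset.range n, (A l).indicator (fun _ => h i) (x i) := fun l g h hgh =>
    (Finset.abs_sum_le_sum_abs _ _).trans (Finset.sum_le_sum fun i _ => by
      by_cases hi : x i ∈ A l <;> simp [hi, hgh i])
  have hcell : ∀ l, |v l * μ.real (A l) - ∫ p in A l, f p ∂μ| ≤
      L * (|cellCount n x (A l) - n * ν.real (Prod.fst ⁻¹' A l)| / n) +
      |∑ i ∈ Finset.range n, (A l).indicator (fun _ => truncate L (y i)) (x i) -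
        n * ∫ z in Prod.fst ⁻¹' A l, truncate L z.2 ∂ν| / n +
      8 * ((∑ i ∈ Finset.range n,
        (A l).indicator (fun _ => |y i - truncate L (y i)|) (x i)) / n) +
      ∫ z in Prod.fst ⁻¹' A l, |z.2 - truncate L z.2| ∂ν + L * (Real.log n / n) := fun l => by
    rw [hμA]
    refine abs_modified_average_mul_sub_le
      (sy := ∑ i ∈ Finset.range n, (A l).indicator (fun _ => y i) (x i))
      hn0 measureReal_nonneg hL hlg ?_ ?_ ?_ ?_ (hq l)
      (fun h => by simp only [hv, if_pos h, cellAverage]) (fun h => by simp only [hv, if_neg h])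
    · exact norm_setIntegral_le_of_norm_le_const (f := fun z : S × ℝ => truncate L z.2)
        (measure_lt_top _ _) fun z _ => abs_truncate_le hL _
    · rw [hf.setIntegral_eq hν (hA l), ← integral_sub hν.integrableOn hTi.integrableOn]
      exact abs_integral_le_integral_abs
    · refine (habs l _ (fun _ => L) fun i => abs_truncate_le hL _).trans (le_of_eq ?_)
      rw [cellCount, Finset.mul_sum]
      refine Finset.sum_congr rfl fun i _ => ?_
      by_cases hi : x i ∈ A l <;> simp [hi]
    · rw [← Finset.sum_sub_distrib]
      refine le_trans (le_of_eq ?_) (habs l (fun i => y i - truncate L (y i)) _ fun i => le_rfl)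
      refine congrArg _ (Finset.sum_congr rfl fun i _ => ?_)
      by_cases hi : x i ∈ A l <;> simp [hi]
  have hsplit : ∫ p, |∑ l, (A l).indicator (fun _ => v l) p - f p| ∂μ =
      ∑ l, ∫ p in A l, |v l - f p| ∂μ := by
    rw [integral_eq_sum_setIntegral hA hdisj huniv
      (g := fun p => |∑ l, (A l).indicator (fun _ => v l) p - f p|) (hesti.sub hfi).abs]
    refine Finset.sum_congr rfl fun l _ => setIntegral_congr_fun (hA l) fun p hp => ?_
    simp only [sum_indicator_of_mem hdisj hp fun k _ => v k]
  have hW : ∑ l, ∑ i ∈ Finset.range n, (A l).indicator (fun _ => |y i - truncate L (y i)|) (x i) =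
      ∑ i ∈ Finset.range n, |y i - truncate L (y i)| := by
    rw [Finset.sum_comm]
    refine Finset.sum_congr rfl fun i _ => ?_
    obtain ⟨l, hl⟩ := Set.mem_iUnion.1 (huniv ▸ Set.mem_univ (x i))
    exact sum_indicator_of_mem hdisj hl fun _ _ => |y i - truncate L (y i)|
  rw [hsplit]
  refine (Finset.sum_le_sum fun l _ => (setIntegral_abs_const_sub_le hfi (v l) (c l)).trans
    (add_le_add_left (hcell l) _)).trans (le_of_eq ?_)
  simp only [Finset.sum_add_distrib, ← Finset.mul_sum, ← Finset.sum_div]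
  rw [hW, ← integral_eq_sum_setIntegral hB hBdisj hBuniv hWi, Finset.sum_const, Finset.card_univ,
    Fintype.card_fin, nsmul_eq_mul, mul_div_assoc]

theorem tendsto_natCast_div_of_mul_log_div {m : ℕ → ℕ}
    (hmn : Tendsto (fun n : ℕ => (m n : ℝ) * Real.log n / n) atTop (𝓝 0)) :
    Tendsto (fun n : ℕ => (m n : ℝ) / n) atTop (𝓝 0) := by
  refine squeeze_zero' (Eventually.of_forall fun n => by positivity) ?_ hmn
  have hlog : Tendsto (fun n : ℕ => Real.log n) atTop atTop :=
    Real.tendsto_log_atTop.comp tendsto_natCast_atTop_atTop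
  filter_upwards [hlog.eventually_ge_atTop 1] with n hn
  have : (m n : ℝ) * 1 ≤ m n * Real.log n := by gcongr
  rw [mul_one] at this
  gcongr

open Classical in
/-- Strong `L¹`-consistency of the modified partitioning estimate for a deterministic sequence of
partitions with `o(n / log n)` cells along which `f` is approximable by piecewise constants. -/
theorem ae_tendsto_integral_abs_modified_sub (hν : Integrable (fun z : S × ℝ => z.2) ν)
    (hf : IsRegressionFunction ν f) {Ω : Type*} [MeasurableSpace Ω] {P : Measure Ω}
    [IsProbabilityMeasure P] {X : ℕ → Ω → S} {Y : ℕ → Ω → ℝ}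
    (hX : ∀ i, Measurable (X i)) (hY : ∀ i, Measurable (Y i))
    (hXY : ∀ i, P.map (fun ω => (X i ω, Y i ω)) = ν)
    (hind : iIndepFun (fun i ω => (X i ω, Y i ω)) P)
    {m : ℕ → ℕ} (hmn : Tendsto (fun n : ℕ => (m n : ℝ) * Real.log n / n) atTop (𝓝 0))
    {A : ∀ n, Fin (m n) → Set S} (hA : ∀ n l, MeasurableSet (A n l))
    (hdisj : ∀ n, Pairwise (Function.onFun Disjoint (A n)))
    (huniv : ∀ᶠ n in atTop, ⋃ l, A n l = Set.univ)
    (happrox : ∀ ε > 0, ∀ᶠ n in atTop, ∃ c : Fin (m n) → ℝ,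
      ∑ l, ∫ p in A n l, |f p - c l| ∂(ν.map Prod.fst) ≤ ε) :
    ∀ᵐ ω ∂P, Tendsto (fun n : ℕ => ∫ p, |∑ l, (A n l).indicator (fun _ =>
        if Real.log n ≤ cellCount n (fun i => X i ω) (A n l)
        then cellAverage n (fun i => X i ω) (fun i => Y i ω) (A n l) else 0) p - f p|
          ∂(ν.map Prod.fst)) atTop (𝓝 0) := by
  have hZ : ∀ i, Measurable fun ω => (X i ω, Y i ω) := fun i => (hX i).prodMk (hY i)
  have hB : ∀ n l, MeasurableSet ((Prod.fst : S × ℝ → S) ⁻¹' A n l) :=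
    fun n l => measurable_fst (hA n l)
  have hBdisj : ∀ n,
      Pairwise (Function.onFun Disjoint fun l => (Prod.fst : S × ℝ → S) ⁻¹' A n l) :=
    fun n i j hij => (hdisj n hij).preimage _
  have hm := tendsto_natCast_div_of_mul_log_div hmn
  have hmle : ∀ᶠ n in atTop, m n ≤ n := by
    filter_upwards [hm.eventually (gt_mem_nhds one_pos), eventually_gt_atTop 0] with n hn hn0
    rw [div_lt_one (by exact_mod_cast hn0)] at hn
    exact_mod_cast hn.le
  have hT : ∀ L, Measurable fun z : S × ℝ => truncate L z.2 := fun L =>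
    (measurable_truncate L).comp measurable_snd
  have h1 := ae_eventually_mul_measureReal_le_eight_mul hZ hXY hind hmle hB
  have h2 := ae_tendsto_sum_abs_sub_setIntegral hZ hXY hind
    (h := fun _ => (1 : ℝ)) measurable_const one_pos (fun _ => by simp) hm hB hBdisj
  have h3 : ∀ k : ℕ, ∀ᵐ ω ∂P, Tendsto (fun n : ℕ => (∑ l, |∑ i ∈ Finset.range n,
      (A n l).indicator (fun _ => truncate k (Y i ω)) (X i ω) -
        n * ∫ z in Prod.fst ⁻¹' A n l, truncate k z.2 ∂ν|) / n) atTop (𝓝 0) := fun k => by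
    -- The bound is `k + 1` because a positive one is required and `k` may be `0`.
    have hb : ∀ z : S × ℝ, |truncate k z.2| ≤ (k : ℝ) + 1 := fun z =>
      (abs_truncate_le k.cast_nonneg _).trans (by linarith)
    have h := ae_tendsto_sum_abs_sub_setIntegral hZ hXY hind (hT k) (by positivity) hb hm hB hBdisj
    simpa only [indicator_preimage_fst] using h
  have h4 : ∀ k : ℕ, ∀ᵐ ω ∂P, Tendsto (fun n : ℕ =>
      (∑ i ∈ Finset.range n, |Y i ω - truncate k (Y i ω)|) / n) atTop
      (𝓝 (∫ z, |z.2 - truncate k z.2| ∂ν)) := fun k => by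
    set φ : S × ℝ → ℝ := fun z => |z.2 - truncate k z.2| with hφdef
    have hφ : Measurable φ := measurable_norm.comp (measurable_snd.sub (hT k))
    have hφi : Integrable φ ν := by
      refine hν.mono hφ.aestronglyMeasurable (ae_of_all _ fun z => ?_)
      simpa [hφdef] using abs_sub_truncate_le k.cast_nonneg z.2
    have h := strong_law_ae_real (μ := P) (fun i ω => φ (X i ω, Y i ω))
      (by
        have := hφi
        rw [← hXY 0, integrable_map_measure hφ.aestronglyMeasurable (hZ 0).aemeasurable] at this
        exact this)
      (fun i j hij => (hind.indepFun hij).comp hφ hφ)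
      (fun i => (IdentDistrib.mk (hZ i).aemeasurable (hZ 0).aemeasurable
        ((hXY i).trans (hXY 0).symm)).comp hφ)
    rwa [integral_comp_eq_of_map_eq hZ hXY hφ 0] at h
  filter_upwards [h1, h2, ae_all_iff.2 h3, ae_all_iff.2 h4] with ω h1 h2 h3 h4
  have h2' : Tendsto (fun n : ℕ => (∑ l, |cellCount n (fun i => X i ω) (A n l) -
      n * ν.real (Prod.fst ⁻¹' A n l)|) / n) atTop (𝓝 0) := by
    simpa only [setIntegral_const, smul_eq_mul, mul_one, indicator_preimage_fst, cellCount] using h2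
  refine tendsto_order.2 ⟨fun a ha => Eventually.of_forall fun n =>
    ha.trans_le (integral_nonneg fun p => abs_nonneg _), fun ε hε => ?_⟩
  -- The residual mean enters nine times, eight through the sample average and once as bias, and `9
  -- / 20 < 1 / 2`. The approximation error adds at most `2 * (ε / 8)`.
  obtain ⟨k, hk⟩ := ((tendsto_integral_abs_sub_truncate hν).eventually
    (gt_mem_nhds (by positivity : 0 < ε / 20))).exists
  have hlim := ((((h2'.const_mul (k : ℝ)).add (h3 k)).add ((h4 k).const_mul 8)).add_const
    (∫ z, |z.2 - truncate k z.2| ∂ν)).add (hmn.const_mul (k : ℝ))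
  have hlt := hlim.eventually_lt_const (u := ε / 2) (by linarith)
  filter_upwards [hlt, h1, huniv, happrox (ε / 8) (by positivity), eventually_gt_atTop 1]
    with n hlt h1 huniv ⟨c, hc⟩ hn
  have hfin := integral_abs_modified_sub_le hν hf (hA n) (hdisj n) huniv k.cast_nonneg hn
    (fun i => X i ω) (fun i => Y i ω)
    (by simpa only [indicator_preimage_fst, cellCount] using h1) c
  linarith

end FixedPartition

/-! ### Measurability and approximation properties of Voronoi cells. -/

section Voronoi

variable {S : Type*} [MetricSpace S]

theorem pairwise_disjoint_voronoiCell {m : ℕ} (nuc : Fin m → S) :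
    Pairwise (Function.onFun Disjoint (voronoiCell nuc)) := fun i _ hij =>
  Set.disjoint_left.2 fun p hi hj =>
    hij ((existsUnique_mem_voronoiCell i.pos nuc p).unique hi hj)

theorem iUnion_voronoiCell {m : ℕ} (hm : 0 < m) (nuc : Fin m → S) :
    ⋃ l, voronoiCell nuc l = Set.univ :=
  Set.eq_univ_of_forall fun p =>
    Set.mem_iUnion.2 (existsUnique_mem_voronoiCell hm nuc p).exists

variable [MeasurableSpace S] [BorelSpace S] [SecondCountableTopology S]

/-- The nuclei depend on the parameter too, because Fubini needs the estimate to be jointly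
measurable in nuclei, sample and point. -/
theorem measurableSet_mem_voronoiCell {α : Type*} [MeasurableSpace α] {m : ℕ}
    {nuc : α → Fin m → S} (hnuc : ∀ i, Measurable fun a => nuc a i) {g : α → S}
    (hg : Measurable g) (l : Fin m) : MeasurableSet {a | g a ∈ voronoiCell (nuc a) l} := by
  have h : {a | g a ∈ voronoiCell (nuc a) l} =
      (⋂ i, {a | dist (g a) (nuc a l) ≤ dist (g a) (nuc a i)}) ∩
        ⋂ i, ⋂ _ : i < l, {a | dist (g a) (nuc a l) < dist (g a) (nuc a i)} := by
    ext a
    simp [voronoiCell]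
  rw [h]
  exact (MeasurableSet.iInter fun i => measurableSet_le (hg.dist (hnuc l)) (hg.dist (hnuc i))).inter
    (MeasurableSet.iInter fun i => MeasurableSet.iInter fun _ =>
      measurableSet_lt (hg.dist (hnuc l)) (hg.dist (hnuc i)))

theorem measurableSet_voronoiCell {m : ℕ} (nuc : Fin m → S) (l : Fin m) :
    MeasurableSet (voronoiCell nuc l) :=
  measurableSet_mem_voronoiCell (nuc := fun _ : S => nuc) (fun _ => measurable_const)
    measurable_id l

theorem measurable_modifiedEstimate {α : Type*} [MeasurableSpace α] {m : ℕ}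
    {nuc : α → Fin m → S} (hnuc : ∀ i, Measurable fun a => nuc a i) (n : ℕ)
    {x : α → ℕ → S} (hx : ∀ i, Measurable fun a => x a i)
    {y : α → ℕ → ℝ} (hy : ∀ i, Measurable fun a => y a i) {g : α → S} (hg : Measurable g) :
    Measurable fun a => modifiedEstimate (nuc a) n (x a) (y a) (g a) := by
  classical
  have hsum : ∀ (l : Fin m) {t : α → ℕ → ℝ}, (∀ i, Measurable fun a => t a i) →
      Measurable fun a => ∑ i ∈ Finset.range n,
        (voronoiCell (nuc a) l).indicator (fun _ => t a i) (x a i) := fun l t ht =>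
    Finset.measurable_sum _ fun i _ =>
      (ht i).indicator (measurableSet_mem_voronoiCell hnuc (hx i) l)
  have hcount : ∀ l, Measurable fun a => cellCount n (x a) (voronoiCell (nuc a) l) := fun l =>
    hsum l (t := fun _ _ => 1) fun _ => measurable_const
  refine Finset.measurable_sum _ fun l _ => Measurable.indicator (Measurable.ite
    (measurableSet_le measurable_const (hcount l)) ((hsum l hy).div (hcount l)) measurable_const)
    (measurableSet_mem_voronoiCell hnuc hg l)

theorem integrable_modifiedEstimate {μ : Measure S} [IsFiniteMeasure μ] {m : ℕ}
    (nuc : Fin m → S) (n : ℕ) (x : ℕ → S) (y : ℕ → ℝ) :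
    Integrable (modifiedEstimate nuc n x y) μ :=
  integrable_finsetSum _ fun l _ =>
    (integrable_const _).indicator (measurableSet_voronoiCell nuc l)

/-- If almost every point is a limit point of the nuclei, an integrable function is approximated in
`L¹` by functions that are constant on the Voronoi cells. -/
theorem eventually_exists_sum_setIntegral_voronoiCell_le {μ : Measure S} [IsFiniteMeasure μ]
    {nuc : ℕ → S} (hnuc : ∀ᵐ p ∂μ, ∀ ε > 0, ∃ i, dist p (nuc i) < ε) {m : ℕ → ℕ}
    (hm : Tendsto m atTop atTop) {f : S → ℝ} (hf : Integrable f μ) {ε : ℝ} (hε : 0 < ε) :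
    ∀ᶠ n in atTop, ∃ c : Fin (m n) → ℝ,
      ∑ l, ∫ p in voronoiCell (fun l : Fin (m n) => nuc l) l, |f p - c l| ∂μ ≤ ε := by
  obtain ⟨g, hg, hgi⟩ := hf.exists_boundedContinuous_integral_sub_le (half_pos hε)
  set A : ∀ n, Fin (m n) → Set S := fun n => voronoiCell fun l : Fin (m n) => nuc l
  set H : ℕ → S → ℝ := fun n p => ∑ l, (A n l).indicator (fun _ => g (nuc l)) p with hH
  have hHi : ∀ n, Integrable (H n) μ := fun n => integrable_finsetSum _ fun l _ =>
    (integrable_const _).indicator (measurableSet_voronoiCell _ l)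
  have hHof : ∀ n l p, p ∈ A n l → H n p = g (nuc l) := fun n l p hp =>
    sum_indicator_of_mem (pairwise_disjoint_voronoiCell _) hp fun (k : Fin (m n)) _ => g (nuc k)
  have hlim : Tendsto (fun n => ∫ p, |g p - H n p| ∂μ) atTop (𝓝 0) := by
    have h := tendsto_integral_filter_of_dominated_convergence (μ := μ) (l := atTop)
      (F := fun n p => |g p - H n p|) (f := fun _ => 0) (fun _ => 2 * ‖g‖)
      (Eventually.of_forall fun n => (hgi.sub (hHi n)).abs.aestronglyMeasurable)
      (by
        filter_upwards [hm.eventually_gt_atTop 0] with n hn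
        refine ae_of_all _ fun p => ?_
        obtain ⟨l, hl⟩ := (existsUnique_mem_voronoiCell hn (fun l => nuc l) p).exists
        rw [hHof n l p hl, Real.norm_eq_abs, abs_abs, ← Real.dist_eq]
        exact g.dist_le_two_norm _ _)
      (integrable_const _)
      (by
        filter_upwards [hnuc] with p hp
        refine tendsto_order.2 ⟨fun a ha => Eventually.of_forall fun n =>
          ha.trans_le (abs_nonneg _), fun a ha => ?_⟩
        obtain ⟨δ, hδ, hgδ⟩ := Metric.continuous_iff.1 g.continuous p a ha
        obtain ⟨i, hi⟩ := hp δ hδ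
        -- From here on `nuc i` is among the nuclei, so the nucleus of the cell of `p` is at least
        -- as close to `p`.
        filter_upwards [hm.eventually_gt_atTop i] with n hn
        obtain ⟨l, hl⟩ :=
          (existsUnique_mem_voronoiCell (i.zero_le.trans_lt hn) (fun l => nuc l) p).exists
        rw [hHof n l p hl, abs_sub_comm, ← Real.dist_eq]
        refine hgδ _ ?_
        rw [dist_comm]
        exact (hl.1 ⟨i, hn⟩).trans_lt hi)
    simpa using h
  filter_upwards [hlim.eventually_lt_const (half_pos hε), hm.eventually_gt_atTop 0] with n hn hn0
  refine ⟨fun l => g (nuc l), ?_⟩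
  have h1 : ∑ l, ∫ p in A n l, |f p - g (nuc l)| ∂μ = ∫ p, |f p - H n p| ∂μ := by
    rw [integral_eq_sum_setIntegral (measurableSet_voronoiCell _)
      (pairwise_disjoint_voronoiCell _) (iUnion_voronoiCell hn0 fun l => nuc l)
      (g := fun p => |f p - H n p|) (hf.sub (hHi n)).abs]
    refine Finset.sum_congr rfl fun l _ =>
      setIntegral_congr_fun (measurableSet_voronoiCell _ l) fun p hp => ?_
    simp only [hHof n l p hp]
  have h2 : ∫ p, |f p - H n p| ∂μ ≤ ∫ p, (‖f p - g p‖ + |g p - H n p|) ∂μ :=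
    integral_mono (hf.sub (hHi n)).abs ((hf.sub hgi).norm.add (hgi.sub (hHi n)).abs)
      fun p => abs_sub_le _ _ _
  have h3 : ∫ p, (‖f p - g p‖ + |g p - H n p|) ∂μ =
      ∫ p, ‖f p - g p‖ ∂μ + ∫ p, |g p - H n p| ∂μ :=
    integral_add (hf.sub hgi).norm (hgi.sub (hHi n)).abs
  refine h1.trans_le ?_
  linarith

end Voronoi

/-! ### Density of the random nuclei and conditioning on them. -/

/-- A sequence of independent random points with common distribution `μ` is almost surely dense in
the support of `μ`. -/
theorem ae_ae_forall_exists_dist_lt {S : Type*} [MetricSpace S] [SecondCountableTopology S]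
    [MeasurableSpace S] [BorelSpace S] {μ : Measure S} [IsFiniteMeasure μ]
    {Ω : Type*} [MeasurableSpace Ω] {P : Measure Ω} {X : ℕ → Ω → S} (hX : ∀ i, Measurable (X i))
    (hlaw : ∀ i, P.map (X i) = μ) (hind : iIndepFun X P) :
    ∀ᵐ ω ∂P, ∀ᵐ p ∂μ, ∀ ε > 0, ∃ i, dist p (X i ω) < ε := by
  -- By the strong law the frequency of visits to `U` tends to `μ U`; without any visit it would be
  -- identically zero.
  have hhit : ∀ U : Set S, MeasurableSet U → μ U ≠ 0 → ∀ᵐ ω ∂P, ∃ i, X i ω ∈ U := by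
    intro U hU hμU
    have hφ : Measurable (U.indicator fun _ => (1 : ℝ)) := measurable_const.indicator hU
    have hφi : Integrable (U.indicator fun _ => (1 : ℝ)) μ := (integrable_const _).indicator hU
    have h := strong_law_ae_real (μ := P) (fun i ω => U.indicator (fun _ => (1 : ℝ)) (X i ω))
      (by
        have := hφi
        rw [← hlaw 0, integrable_map_measure hφ.aestronglyMeasurable (hX 0).aemeasurable] at this
        exact this)
      (fun i j hij => (hind.indepFun hij).comp hφ hφ)
      (fun i => (IdentDistrib.mk (hX i).aemeasurable (hX 0).aemeasurable
        ((hlaw i).trans (hlaw 0).symm)).comp hφ)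
    rw [integral_comp_eq_of_map_eq hX hlaw hφ 0, integral_indicator hU, setIntegral_const,
      smul_eq_mul, mul_one] at h
    filter_upwards [h] with ω hω
    by_contra! hcon
    have h0 : (fun n : ℕ => (∑ i ∈ Finset.range n, U.indicator (fun _ => (1 : ℝ)) (X i ω)) / n) =
        fun _ => 0 := by
      funext n
      rw [Finset.sum_eq_zero fun i _ => Set.indicator_of_notMem (hcon i) _, zero_div]
    rw [h0] at hω
    have := tendsto_nhds_unique hω tendsto_const_nhds
    exact hμU ((measureReal_eq_zero_iff (measure_ne_top _ _)).1 this)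
  have hbasis := TopologicalSpace.isBasis_countableBasis S
  have hctb := TopologicalSpace.countable_countableBasis S
  have h1 : ∀ᵐ ω ∂P, ∀ U ∈ TopologicalSpace.countableBasis S, μ U ≠ 0 → ∃ i, X i ω ∈ U :=
    (ae_ball_iff hctb).2 fun U hU => by
      by_cases h0 : μ U = 0
      · exact ae_of_all _ fun _ h => absurd h0 h
      · exact (hhit U (hbasis.isOpen hU).measurableSet h0).mono fun _ h _ => h
  -- The null basic open sets are countably many, so almost every point avoids them all.
  have h2 : ∀ᵐ p ∂μ, ∀ U ∈ TopologicalSpace.countableBasis S, p ∈ U → μ U ≠ 0 :=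
    (ae_ball_iff hctb).2 fun U _ => by
      by_cases h0 : μ U = 0
      · exact (measure_eq_zero_iff_ae_notMem.1 h0).mono fun p hp hpU => absurd hpU hp
      · exact ae_of_all _ fun _ _ => h0
  filter_upwards [h1] with ω hω
  filter_upwards [h2] with p hp ε hε
  obtain ⟨U, hU, hpU, hsub⟩ :=
    hbasis.exists_subset_of_mem_open (Metric.mem_ball_self hε) Metric.isOpen_ball
  obtain ⟨i, hi⟩ := hω U hU (hp U hU hpU)
  exact ⟨i, by simpa only [dist_comm] using Metric.mem_ball.1 (hsub hi)⟩

/-- For independent random variables, an almost sure property of the pair can be checked for almost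
every fixed value of the first one. -/
theorem ae_mem_of_ae_ae_mem_of_indepFun {Ω α β : Type*} [MeasurableSpace Ω] [MeasurableSpace α]
    [MeasurableSpace β] {P : Measure Ω} [IsFiniteMeasure P] {U : Ω → α} {V : Ω → β}
    (hU : Measurable U) (hV : Measurable V) (hind : IndepFun U V P) {G : Set (α × β)}
    (hG : MeasurableSet G) (h : ∀ᵐ ω' ∂P, ∀ᵐ ω ∂P, (U ω', V ω) ∈ G) :
    ∀ᵐ ω ∂P, (U ω, V ω) ∈ G := by
  refine (ae_map_iff (hU.prodMk hV).aemeasurable hG).1 ?_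
  rw [(indepFun_iff_map_prod_eq_prod_map_map hU.aemeasurable hV.aemeasurable).1 hind]
  refine (Measure.ae_prod_mem_iff_ae_ae_mem hG).2 ?_
  have hmeas : MeasurableSet {u | ∀ᵐ v ∂(P.map V), (u, v) ∈ G} :=
    measurable_measure_prodMk_left hG.compl (measurableSet_singleton 0)
  refine (ae_map_iff hU.aemeasurable hmeas).2 ?_
  filter_upwards [h] with ω' hω'
  exact (ae_map_iff hV.aemeasurable (measurable_prodMk_left hG)).2 hω'

end ProtoNN

theorem theorem3 {S : Type*} [MetricSpace S] [TopologicalSpace.SeparableSpace S]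
    [MeasurableSpace S] [BorelSpace S]
    -- the numbers of nuclei
    (m : ℕ → ℕ) (hm : Tendsto m atTop atTop)
    (hmn : Tendsto (fun n : ℕ => (m n : ℝ) * Real.log n / n) atTop (𝓝 0))
    -- the distribution of `(X, Y)`, with `E|Y| < ∞`, and its regression function
    (ν : Measure (S × ℝ)) [IsProbabilityMeasure ν]
    (hν : Integrable (fun z : S × ℝ => z.2) ν)
    (f : S → ℝ) (hf : ProtoNN.IsRegressionFunction ν f)
    {Ω : Type*} [MeasurableSpace Ω] (P : Measure Ω) [IsProbabilityMeasure P]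
    -- the labeled sample: independent copies of `(X, Y)`
    (X : ℕ → Ω → S) (Y : ℕ → Ω → ℝ)
    (hX : ∀ i, Measurable (X i)) (hY : ∀ i, Measurable (Y i))
    (hXY : ∀ i, P.map (fun ω => (X i ω, Y i ω)) = ν)
    (hXYindep : iIndepFun (fun i ω => (X i ω, Y i ω)) P)
    -- the unlabeled sample: independent copies of `X`, independent of the labeled sample
    (X' : ℕ → Ω → S) (hX' : ∀ i, Measurable (X' i))
    (hX'law : ∀ i, P.map (X' i) = ν.map Prod.fst)
    (hX'indep : iIndepFun X' P)
    (hindep : IndepFun (fun ω (i : ℕ) => (X i ω, Y i ω)) (fun ω (i : ℕ) => X' i ω) P) :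
    ∀ᵐ ω ∂P,
      (∀ n, Integrable (fun x => ProtoNN.modifiedEstimate (fun l : Fin (m n) => X' l ω) n
        (fun i => X i ω) (fun i => Y i ω) x - f x) (ν.map Prod.fst)) ∧
      Tendsto (fun n => ∫ x, |ProtoNN.modifiedEstimate (fun l : Fin (m n) => X' l ω) n
        (fun i => X i ω) (fun i => Y i ω) x - f x| ∂(ν.map Prod.fst)) atTop (𝓝 0) := by
  have : SecondCountableTopology S := UniformSpace.secondCountable_of_separable S
  have : IsProbabilityMeasure (ν.map Prod.fst) :=
    Measure.isProbabilityMeasure_map measurable_fst.aemeasurable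
  have hfi : Integrable f (ν.map Prod.fst) := hf.integrable
  have hU : Measurable fun ω (i : ℕ) => X' i ω := measurable_pi_lambda _ hX'
  have hV : Measurable fun ω (i : ℕ) => (X i ω, Y i ω) :=
    measurable_pi_lambda _ fun i => (hX i).prodMk (hY i)
  let G : Set ((ℕ → S) × (ℕ → S × ℝ)) := {q | Tendsto (fun n => ∫ x,
    |ProtoNN.modifiedEstimate (fun l : Fin (m n) => q.1 l) n (fun i => (q.2 i).1)
      (fun i => (q.2 i).2) x - f x| ∂(ν.map Prod.fst)) atTop (𝓝 0)}
  have hG : MeasurableSet G := by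
    refine measurableSet_tendsto _ fun n => (StronglyMeasurable.integral_prod_right
      (f := fun (q : (ℕ → S) × (ℕ → S × ℝ)) x => |ProtoNN.modifiedEstimate
        (fun l : Fin (m n) => q.1 l) n (fun i => (q.2 i).1) (fun i => (q.2 i).2) x - f x|)
      (Measurable.stronglyMeasurable ?_)).measurable
    refine measurable_norm.comp (Measurable.sub ?_ (hf.1.comp measurable_snd))
    exact ProtoNN.measurable_modifiedEstimate
      (α := ((ℕ → S) × (ℕ → S × ℝ)) × S)
      (nuc := fun w l => w.1.1 l) (x := fun w i => (w.1.2 i).1) (y := fun w i => (w.1.2 i).2)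
      (fun i => (measurable_pi_apply _).comp (measurable_fst.comp measurable_fst)) n
      (fun i => measurable_fst.comp
        ((measurable_pi_apply i).comp (measurable_snd.comp measurable_fst)))
      (fun i => measurable_snd.comp
        ((measurable_pi_apply i).comp (measurable_snd.comp measurable_fst))) measurable_snd
  have hmain : ∀ᵐ ω ∂P, ((fun i => X' i ω, fun i => (X i ω, Y i ω)) :
      (ℕ → S) × (ℕ → S × ℝ)) ∈ G := by
    refine ProtoNN.ae_mem_of_ae_ae_mem_of_indepFun hU hV hindep.symm hG ?_
    filter_upwards [ProtoNN.ae_ae_forall_exists_dist_lt hX' hX'law hX'indep] with ω' hω'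
    exact ProtoNN.ae_tendsto_integral_abs_modified_sub hν hf hX hY hXY hXYindep hmn
      (A := fun n => ProtoNN.voronoiCell fun l : Fin (m n) => X' l ω')
      (fun n => ProtoNN.measurableSet_voronoiCell _)
      (fun n => ProtoNN.pairwise_disjoint_voronoiCell _)
      ((hm.eventually_gt_atTop 0).mono fun n hn => ProtoNN.iUnion_voronoiCell hn _)
      fun ε hε => ProtoNN.eventually_exists_sum_setIntegral_voronoiCell_le hω' hm hfi hε
  filter_upwards [hmain] with ω hω
  exact ⟨fun n => (ProtoNN.integrable_modifiedEstimate _ n _ _).sub hfi, hω⟩
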